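/- Let $\mathbb K$ be $\mathbb R$ or $\mathbb C$. A topological $\mathbb K$-vector space is *weakly complete* if it is isomorphic, as a topological vector space, to a power $\mathbb K^J$ with the product topology; a *weakly complete unital algebra* is a unital associative topological $\mathbb K$-algebra whose underlying topological vector space is weakly complete. For such an algebra $A$ let $A_{\rm Lie}$ be the topological Lie algebra on $A$ with bracket $[a,b]=ab-ba$. A topological Lie algebra $\mathfrak g$ over $\mathbb K$ is *profinite-dimensional* if the canonical map $\mathfrak g\to\lim_I\mathfrak g/I$, where $I$ ranges over the closed ideals of $\mathfrak g$ with $\dim\mathfrak g/I<\infty$, is an isomorphism of topological Lie algebras. A *weakly complete enveloping algebra* of $\mathfrak g$ is a weakly complete unital algebra $\mathbf U(\mathfrak g)$ together with a continuous Lie algebra morphism $\lambda_{\mathfrak g}\colon\mathfrak g\to\mathbf U(\mathfrak g)_{\rm Lie}$ such that for every weakly complete unital algebra $A$ and every continuous Lie algebra morphism $f\colon\mathfrak g\to A_{\rm Lie}$ there is a unique continuous unital algebra morphism $f'\colon\mathbf U(\mathfrak g)\to A$ with $f=f'\circ\lambda_{\mathfrak g}$. **Corollary 1.8.** For any profinite-dimensional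 Lie algebra $\mathfrak g$ over $\mathbb K$, the weakly complete enveloping algebra $\mathbf U(\mathfrak g)$ exists, and the unital associative subalgebra $\langle\mathfrak g\rangle$ of $\mathbf U(\mathfrak g)$ generated by (the image under $\lambda_{\mathfrak g}$ of) $\mathfrak g$ is dense in $\mathbf U(\mathfrak g)$. -/

import Mathlib

universe u v w

-- On an associative algebra the bracket is the commutator `⁅a, b⁆ = a * b - b * a`.
attribute [local instance] LieRing.ofAssociativeRing

/-- A topological Lie algebra over a topological field: vector addition, scalar multiplication
and the bracket are (jointly) continuous. -/
class IsTopologicalLieAlgebra (𝕜 : Type u) (𝔤 : Type v) [RCLike 𝕜] [LieRing 𝔤] [LieAlgebra 𝕜 𝔤]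
    [TopologicalSpace 𝔤] : Prop extends IsTopologicalAddGroup 𝔤, ContinuousSMul 𝕜 𝔤 where
  continuous_bracket : Continuous fun p : 𝔤 × 𝔤 => ⁅p.1, p.2⁆

namespace ProfiniteLie

section
variable (𝕜 : Type u) (𝔤 : Type v) [RCLike 𝕜] [LieRing 𝔤] [LieAlgebra 𝕜 𝔤] [TopologicalSpace 𝔤]

/-- The set of all closed ideals `I` of `𝔤` such that `𝔤 / I` is finite-dimensional, ordered by
inclusion. -/
abbrev CofiniteIdeal : Type v :=
  {I : LieIdeal 𝕜 𝔤 // IsClosed (I : Set 𝔤) ∧ FiniteDimensional 𝕜 (𝔤 ⧸ I.toSubmodule)}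

/-- The projective limit of the quotients `𝔤 / I`, as a set of compatible families in the product
of all these quotients (each of which carries the quotient topology). -/
def quotientLimit : Set (∀ I : CofiniteIdeal 𝕜 𝔤, 𝔤 ⧸ I.1.toSubmodule) :=
  {x | ∀ (I J : CofiniteIdeal 𝕜 𝔤) (h : I.1.toSubmodule ≤ J.1.toSubmodule),
    Submodule.factor h (x I) = x J}

/-- The canonical map of `𝔤` to the product of all its quotients `𝔤 / I`. -/
def toQuotients (x : 𝔤) (I : CofiniteIdeal 𝕜 𝔤) : 𝔤 ⧸ I.1.toSubmodule :=
  I.1.toSubmodule.mkQ x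

/-- A topological Lie algebra `𝔤` is profinite-dimensional if the canonical map to the projective
limit of its quotients `𝔤 / I` is an isomorphism of topological Lie algebras. As this map
always preserves the operations, this means that it is a homeomorphism of `𝔤` onto the limit. -/
class IsProfiniteDimensional : Prop extends IsTopologicalLieAlgebra 𝕜 𝔤 where
  isEmbedding : Topology.IsEmbedding (toQuotients 𝕜 𝔤)
  range_eq : Set.range (toQuotients 𝕜 𝔤) = quotientLimit 𝕜 𝔤

end

/-- A topological vector space is weakly complete if it is isomorphic, algebraically and
topologically, to a power `𝕜 ^ J` with the product topology. (The exponent may be taken in the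
universe of the space, because `J` embeds into `𝕜 ^ J`.) -/
def IsWeaklyComplete (𝕜 : Type u) (V : Type v) [RCLike 𝕜] [AddCommGroup V] [Module 𝕜 V]
    [TopologicalSpace V] : Prop :=
  ∃ J : Type v, Nonempty (V ≃L[𝕜] (J → 𝕜))

/-- A weakly complete (associative) unital algebra: a topological algebra whose underlying
topological vector space is weakly complete. -/
class IsWeaklyCompleteAlgebra (𝕜 : Type u) (A : Type v) [RCLike 𝕜] [Ring A] [Algebra 𝕜 A]
    [TopologicalSpace A] : Prop extends IsTopologicalRing A where
  isWeaklyComplete : IsWeaklyComplete 𝕜 A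

/-- `(U, lam)` is a weakly complete enveloping algebra of `𝔤`: it is a universal arrow from `𝔤`
to the functor that sends a weakly complete unital algebra `A` to the topological Lie algebra on
`A` with the bracket `[a, b] = a b - b a`. Morphisms on both sides are the continuous ones, and
algebra morphisms preserve the unit. -/
structure IsEnvelopingAlgebra (𝕜 : Type u) (𝔤 : Type v) [RCLike 𝕜] [LieRing 𝔤] [LieAlgebra 𝕜 𝔤]
    [TopologicalSpace 𝔤] (U : Type w) [Ring U] [Algebra 𝕜 U] [TopologicalSpace U]
    (lam : 𝔤 →ₗ⁅𝕜⁆ U) : Prop where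
  weaklyComplete : IsWeaklyCompleteAlgebra 𝕜 U
  continuous : Continuous lam
  existsUnique_lift : ∀ (A : Type w) [Ring A] [Algebra 𝕜 A] [TopologicalSpace A]
    [IsWeaklyCompleteAlgebra 𝕜 A] (f : 𝔤 →ₗ⁅𝕜⁆ A), Continuous f →
    ∃! f' : U →A[𝕜] A, ∀ x : 𝔤, f' (lam x) = f x

end ProfiniteLie

/-! The point is that a weakly complete algebra `A` has enough finite-dimensional representations:
for a continuous functional `w`, joint continuity of multiplication forces the left ideal `{y | w (A
y) = 0}` to have finite codimension, so `w` is a coefficient of a continuous matrix representation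
(`exists_representation`). Hence the continuous matrix representations of `𝔤`, indexed independently
of `A`, suffice: the closed subalgebra they generate in the product of their matrix algebras is
universal (`exists_lift_closure`), and weakly complete because closed subspaces of powers of `𝕜` are
again powers. For density, the universal property retracts `U` onto the closure of the generated
subalgebra. -/

namespace ProfiniteLie

open Topology Filter

/-! ### Closed subspaces of weakly complete spaces -/

section WeaklyComplete

variable {𝕜 : Type u} [RCLike 𝕜]

/-- A point of a product that is matched by points of `V` on every finite set of coordinates lies
in the closure of `V`. -/
theorem mem_closure_pi_of_forall_finset {J : Type v} {V : Set (J → 𝕜)} {x : J → 𝕜}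
    (h : ∀ F : Finset J, ∃ y ∈ V, ∀ j ∈ F, y j = x j) : x ∈ closure V := by
  rw [mem_closure_iff_nhds]
  intro t ht
  rw [nhds_pi, Filter.mem_pi'] at ht
  obtain ⟨F, s, hs, hst⟩ := ht
  obtain ⟨y, hyV, hy⟩ := h F
  exact ⟨y, hst fun j hj => by rw [hy j hj]; exact mem_of_mem_nhds (hs j), hyV⟩

/-- A closed subspace of a power of `𝕜` is cut out by the finite linear relations between the
coordinates that hold on it. -/
theorem mem_of_forall_relation {J : Type v} {V : Submodule 𝕜 (J → 𝕜)}
    (hV : IsClosed (V : Set (J → 𝕜))) {x : J → 𝕜}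
    (hx : ∀ (F : Finset J) (c : J → 𝕜), (∀ y ∈ V, ∑ j ∈ F, c j * y j = 0) →
      ∑ j ∈ F, c j * x j = 0) : x ∈ V := by
  rw [← SetLike.mem_coe, ← hV.closure_eq]
  refine mem_closure_pi_of_forall_finset fun F => ?_
  let r : (J → 𝕜) →ₗ[𝕜] (F → 𝕜) := LinearMap.funLeft 𝕜 𝕜 Subtype.val
  by_cases hr : r x ∈ V.map r
  · obtain ⟨y, hy, hyx⟩ := hr
    exact ⟨y, hy, fun j hj => congrFun hyx ⟨j, hj⟩⟩
  · exfalso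
    -- The coefficients of a functional separating `r x` from `r V` form a relation on `V` that `x`
    -- violates.
    obtain ⟨φ, hφx, hφ⟩ := Submodule.exists_le_ker_of_notMem hr
    classical
    let c : J → 𝕜 := fun j => if hj : j ∈ F then φ (Pi.single ⟨j, hj⟩ 1) else 0
    have key : ∀ y, φ (r y) = ∑ j ∈ F, c j * y j := by
      intro y
      rw [LinearMap.pi_apply_eq_sum_univ φ (r y), ← Finset.sum_coe_sort F]
      refine Finset.sum_congr rfl fun j _ => ?_
      simp only [c, j.2, dif_pos, smul_eq_mul]
      rw [mul_comm]
      congr 2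
      ext k
      simp [Pi.single_apply, eq_comm]
    refine hφx ?_
    rw [key]
    refine hx F c fun y hy => ?_
    rw [← key]
    exact hφ ⟨y, hy, rfl⟩

/-- A maximal linearly independent family of restricted coordinates serves as free coordinates on
`V`; the others are finite combinations of these, so the inverse is continuous. -/
theorem isWeaklyComplete_of_isClosed_pi {J : Type v} (V : Submodule 𝕜 (J → 𝕜))
    (hV : IsClosed (V : Set (J → 𝕜))) :
    ∃ κ : Type v, Nonempty (V ≃L[𝕜] (κ → 𝕜)) := by
  let p : J → Module.Dual 𝕜 V := fun j => (LinearMap.proj j).comp V.subtype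
  obtain ⟨κ, a, -, hspan, hli⟩ := exists_linearIndependent' 𝕜 p
  have hmem : ∀ j, p j ∈ Submodule.span 𝕜 (Set.range (p ∘ a)) := fun j => by
    rw [hspan]
    exact Submodule.subset_span ⟨j, rfl⟩
  let c : J → κ →₀ 𝕜 := fun j => hli.repr ⟨p j, hmem j⟩
  have hc : ∀ (j : J) (v : V), (v : J → 𝕜) j = (c j).sum fun k t => t * (v : J → 𝕜) (a k) := by
    intro j v
    have h := congrArg (fun φ : Module.Dual 𝕜 V => φ v)
      (hli.linearCombination_repr ⟨p j, hmem j⟩)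
    simp only [Finsupp.linearCombination_apply, Finsupp.sum, LinearMap.sum_apply,
      LinearMap.smul_apply, Function.comp_apply] at h
    exact h.symm
  have hca : ∀ k, c (a k) = Finsupp.single k 1 := fun k => hli.repr_eq_single k _ rfl
  -- Relations valid on `V` pass to the coefficient vectors `c j`, so every `inv y` satisfies them.
  have hcrel : ∀ (F : Finset J) (t : J → 𝕜), (∀ y ∈ V, ∑ j ∈ F, t j * y j = 0) →
      ∑ j ∈ F, t j • c j = 0 := by
    intro F t ht
    have : ∑ j ∈ F, t j • (⟨p j, hmem j⟩ : Submodule.span 𝕜 (Set.range (p ∘ a))) = 0 := by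
      ext v
      simpa [LinearMap.sum_apply, p] using ht v v.2
    simpa only [map_sum, map_smul, map_zero] using congrArg hli.repr this
  let inv : (κ → 𝕜) →L[𝕜] (J → 𝕜) :=
    ContinuousLinearMap.pi fun j => ∑ k ∈ (c j).support, c j k • ContinuousLinearMap.proj k
  have inv_apply : ∀ y j, inv y j = Finsupp.linearCombination 𝕜 y (c j) := by
    intro y j
    simp [inv, Finsupp.linearCombination_apply, Finsupp.sum]
  have inv_mem : ∀ y, inv y ∈ V := by
    intro y
    refine mem_of_forall_relation hV fun F t ht => ?_
    have := congrArg (Finsupp.linearCombination 𝕜 y) (hcrel F t ht)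
    simpa [map_sum, inv_apply] using this
  let fwd : V →L[𝕜] (κ → 𝕜) :=
    ContinuousLinearMap.pi fun k => (ContinuousLinearMap.proj (a k)).comp V.subtypeL
  refine ⟨κ, ⟨ContinuousLinearEquiv.equivOfInverse fwd (inv.codRestrict V inv_mem) ?_ ?_⟩⟩
  · intro v
    ext j
    change inv (fwd v) j = _
    rw [inv_apply, hc j v]
    rfl
  · intro y
    ext k
    change inv y (a k) = y k
    rw [inv_apply, hca]
    simp

theorem IsWeaklyComplete.of_isClosed {E : Type v} [AddCommGroup E] [Module 𝕜 E]
    [TopologicalSpace E] (hE : IsWeaklyComplete 𝕜 E) (V : Submodule 𝕜 E)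
    (hV : IsClosed (V : Set E)) : IsWeaklyComplete 𝕜 V := by
  obtain ⟨J, ⟨e⟩⟩ := hE
  have himg : IsClosed ((V.map (e : E →ₗ[𝕜] (J → 𝕜)) : Submodule 𝕜 (J → 𝕜)) : Set (J → 𝕜)) := by
    rw [Submodule.map_coe]
    exact e.toHomeomorph.isClosedMap _ hV
  obtain ⟨κ, ⟨e'⟩⟩ := isWeaklyComplete_of_isClosed_pi _ himg
  exact ⟨κ, ⟨(e.submoduleMap V).trans e'⟩⟩

theorem IsWeaklyComplete.t2Space {E : Type v} [AddCommGroup E] [Module 𝕜 E]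
    [TopologicalSpace E] (hE : IsWeaklyComplete 𝕜 E) : T2Space E := by
  obtain ⟨J, ⟨e⟩⟩ := hE
  exact e.toHomeomorph.symm.t2Space

theorem IsWeaklyComplete.continuousSMul {E : Type v} [AddCommGroup E] [Module 𝕜 E]
    [TopologicalSpace E] (hE : IsWeaklyComplete 𝕜 E) : ContinuousSMul 𝕜 E := by
  obtain ⟨J, ⟨e⟩⟩ := hE
  exact e.toHomeomorph.isInducing.continuousSMul continuous_id (map_smul e _ _)

/-- A closed subalgebra of a weakly complete algebra is weakly complete. -/
theorem IsWeaklyCompleteAlgebra.of_isClosed {A : Type v} [Ring A] [Algebra 𝕜 A]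
    [TopologicalSpace A] [hA : IsWeaklyCompleteAlgebra 𝕜 A] (S : Subalgebra 𝕜 A)
    (hS : IsClosed (S : Set A)) : IsWeaklyCompleteAlgebra 𝕜 S where
  toIsTopologicalRing := inferInstanceAs (IsTopologicalRing S.toSubring)
  isWeaklyComplete := hA.isWeaklyComplete.of_isClosed (Subalgebra.toSubmodule S) hS

end WeaklyComplete

/-! ### Finite-dimensional representations of weakly complete algebras -/

section Representation

variable {𝕜 : Type u} [RCLike 𝕜] {A : Type v} [Ring A] [Algebra 𝕜 A] [TopologicalSpace A]

/-- For a continuous functional `w` there are finitely many coordinates whose vanishing at `y`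
forces `w (x * y) = 0` for all `x`. -/
theorem exists_finset_forall_mul_eq_zero [IsTopologicalRing A] [ContinuousSMul 𝕜 A] {J : Type v}
    (e : A ≃L[𝕜] (J → 𝕜)) (w : A →L[𝕜] 𝕜) :
    ∃ F : Finset J, ∀ y, (∀ j ∈ F, e y j = 0) → ∀ x, w (x * y) = 0 := by
  have hcont : Continuous fun q : A × A => w (q.1 * q.2) := by fun_prop
  have hnhds : {q : A × A | ‖w (q.1 * q.2)‖ < 1} ∈ 𝓝 ((0 : A), (0 : A)) :=
    (isOpen_lt hcont.norm continuous_const).mem_nhds (by simp)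
  rw [nhds_prod_eq, mem_prod_iff] at hnhds
  obtain ⟨N, hN, M, hM, hNM⟩ := hnhds
  have hM' : e.symm ⁻¹' M ∈ 𝓝 (0 : J → 𝕜) :=
    e.symm.continuous.continuousAt.preimage_mem_nhds (by simpa using hM)
  rw [nhds_pi, Filter.mem_pi'] at hM'
  obtain ⟨F, s, hs, hsM⟩ := hM'
  refine ⟨F, fun y hy x => ?_⟩
  -- The neighbourhood restricts only the coordinates in `F`, so it contains the whole line through
  -- `y`.
  have hyM : ∀ t : 𝕜, t • y ∈ M := fun t => by
    have : e (t • y) ∈ e.symm ⁻¹' M := hsM fun j hj => by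
      simpa [hy j hj] using mem_of_mem_nhds (hs j)
    simpa using this
  have hx : Tendsto (fun c : 𝕜 => c • x) (𝓝[≠] 0) (𝓝 0) := by
    have : Continuous fun c : 𝕜 => c • x := by fun_prop
    simpa using (this.tendsto 0).mono_left nhdsWithin_le_nhds
  obtain ⟨c, hcN, hc⟩ := ((hx.eventually_mem hN).and eventually_mem_nhdsWithin).exists
  by_contra hne
  -- The scalar on `y` is chosen to make the value of `w` exactly `1`.
  have hlt : ‖w ((c • x) * ((c * w (x * y))⁻¹ • y))‖ < 1 :=
    hNM (Set.mk_mem_prod hcN (hyM _))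
  have hc : c ≠ 0 := hc
  rw [smul_mul_smul_comm, map_smul, smul_eq_mul, mul_inv] at hlt
  have : c * (c⁻¹ * (w (x * y))⁻¹) * w (x * y) = 1 := by field_simp
  rw [this] at hlt
  simp at hlt

/-- Every continuous functional on a weakly complete algebra is a coefficient of a continuous
finite-dimensional representation. -/
theorem exists_representation [hA : IsWeaklyCompleteAlgebra 𝕜 A] (w : A →L[𝕜] 𝕜) :
    ∃ (n : ℕ) (ρ : A →ₐ[𝕜] Matrix (Fin n) (Fin n) 𝕜) (l : Matrix (Fin n) (Fin n) 𝕜 →ₗ[𝕜] 𝕜),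
      Continuous ρ ∧ ∀ a, w a = l (ρ a) := by
  have := hA.isWeaklyComplete.continuousSMul
  obtain ⟨J, ⟨e⟩⟩ := hA.isWeaklyComplete
  obtain ⟨F, hF⟩ := exists_finset_forall_mul_eq_zero e w
  classical
  let L : Submodule A A :=
    { carrier := {y | ∀ x, w (x * y) = 0}
      add_mem' := fun {a b} ha hb x => by rw [mul_add, map_add, ha, hb, add_zero]
      zero_mem' := fun x => by simp
      smul_mem' := fun c y hy x => by rw [smul_eq_mul, ← mul_assoc]; exact hy _ }
  let v : J → A ⧸ L := fun j => L.mkQ (e.symm (Pi.single j 1))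
  have hmk : ∀ a, L.mkQ a = ∑ j ∈ F, e a j • v j := by
    intro a
    have h : a - ∑ j ∈ F, e a j • e.symm (Pi.single j 1) ∈ L := by
      refine fun x => hF _ (fun k hk => ?_) x
      simp [Finset.sum_apply, Pi.single_apply, hk]
    have h' := (Submodule.Quotient.eq L).2 h
    rw [Submodule.mkQ_apply, h', ← Submodule.mkQ_apply, map_sum]
    rfl
  have hfin : FiniteDimensional 𝕜 (A ⧸ L) := by
    refine ⟨⟨F.image v, ?_⟩⟩
    rw [eq_top_iff]
    rintro q -
    obtain ⟨a, rfl⟩ := L.mkQ_surjective q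
    rw [hmk]
    refine Submodule.sum_mem _ fun j hj => Submodule.smul_mem _ _ (Submodule.subset_span ?_)
    exact Finset.mem_coe.2 (Finset.mem_image_of_mem v hj)
  let b := Module.finBasis 𝕜 (A ⧸ L)
  have hg : ∀ g : (A ⧸ L) →ₗ[𝕜] 𝕜, Continuous fun a => g (L.mkQ a) := by
    intro g
    have : (fun a => g (L.mkQ a)) = fun a => ∑ j ∈ F, e a j * g (v j) := by
      funext a
      rw [hmk, map_sum]
      simp
    rw [this]
    exact continuous_finsetSum _ fun j _ =>
      ((continuous_apply j).comp e.continuous).mul continuous_const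
  let ρ : A →ₐ[𝕜] Matrix _ _ 𝕜 :=
    (LinearMap.toMatrixAlgEquiv b).toAlgHom.comp (Algebra.lsmul 𝕜 𝕜 (A ⧸ L))
  -- Taking `x = 1` in the definition of `L` shows that `w` vanishes on `L`.
  let wL : (A ⧸ L) →ₗ[𝕜] 𝕜 :=
    { toFun := Quotient.lift (fun a => w a) fun x y hxy => by
        have h := (Submodule.quotientRel_def L).1 hxy 1
        rwa [one_mul, map_sub, sub_eq_zero] at h
      map_add' := by
        rintro ⟨x⟩ ⟨y⟩
        exact map_add w x y
      map_smul' := by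
        rintro c ⟨x⟩
        exact map_smul w c x }
  let l : Matrix (Fin _) (Fin _) 𝕜 →ₗ[𝕜] 𝕜 :=
    wL ∘ₗ (LinearMap.applyₗ (L.mkQ 1)) ∘ₗ (LinearMap.toMatrixAlgEquiv b).symm.toLinearMap
  refine ⟨_, ρ, l, ?_, fun a => ?_⟩
  · refine continuous_matrix fun i j => ?_
    obtain ⟨y, hy⟩ := L.mkQ_surjective (b j)
    have : (fun a => ρ a i j) = fun a => b.coord i (L.mkQ (a * y)) := by
      funext a
      simp only [ρ, AlgHom.comp_apply]
      erw [LinearMap.toMatrixAlgEquiv_apply]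
      rw [← hy]
      rfl
    rw [this]
    exact (hg (b.coord i)).comp (continuous_id.mul continuous_const)
  · have : l (ρ a) = wL (a • L.mkQ 1) := by
      simp [l, ρ]
    rw [this, ← map_smul, smul_eq_mul, mul_one]
    rfl

end Representation

/-! ### Closures of generated subalgebras -/

section Closure

variable {𝕜 : Type u} [RCLike 𝕜] {𝔤 : Type v} [LieRing 𝔤] [LieAlgebra 𝕜 𝔤]

/-- A Lie algebra morphism into an associative algebra, with values in the closure of the
subalgebra generated by its image. -/
def toClosure {A : Type w} [Ring A] [Algebra 𝕜 A] [TopologicalSpace A] [IsTopologicalRing A]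
    (f : 𝔤 →ₗ⁅𝕜⁆ A) :
    𝔤 →ₗ⁅𝕜⁆ (Algebra.adjoin 𝕜 (Set.range f)).topologicalClosure where
  toFun x := ⟨f x, Subalgebra.le_topologicalClosure _ (Algebra.subset_adjoin ⟨x, rfl⟩)⟩
  map_add' x y := Subtype.ext (map_add f x y)
  map_smul' c x := Subtype.ext (map_smul f c x)
  map_lie' {x y} := Subtype.ext (LieHom.map_lie f x y)

/-- Continuous algebra morphisms out of the closure of a generated subalgebra are determined on
the generators. -/
theorem algHom_closure_ext {A B : Type w} [Ring A] [Algebra 𝕜 A] [TopologicalSpace A]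
    [IsTopologicalRing A] [Ring B] [Algebra 𝕜 B] [TopologicalSpace B] [T2Space B]
    {f : 𝔤 →ₗ⁅𝕜⁆ A} {g h : (Algebra.adjoin 𝕜 (Set.range f)).topologicalClosure →A[𝕜] B}
    (hgh : ∀ x, g (toClosure f x) = h (toClosure f x)) : g = h := by
  have hadj : ∀ a (ha : a ∈ Algebra.adjoin 𝕜 (Set.range f)),
      g ⟨a, Subalgebra.le_topologicalClosure _ ha⟩ =
        h ⟨a, Subalgebra.le_topologicalClosure _ ha⟩ := by
    intro a ha
    induction ha using Algebra.adjoin_induction with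
    | mem a ha => obtain ⟨x, rfl⟩ := ha; exact hgh x
    | algebraMap r => exact (AlgHomClass.commutes g r).trans (AlgHomClass.commutes h r).symm
    | add a b ha hb iha ihb =>
      exact (map_add g ⟨a, _⟩ ⟨b, _⟩).trans
        ((congrArg₂ (· + ·) iha ihb).trans (map_add h ⟨a, _⟩ ⟨b, _⟩).symm)
    | mul a b ha hb iha ihb =>
      exact (map_mul g ⟨a, _⟩ ⟨b, _⟩).trans
        ((congrArg₂ (· * ·) iha ihb).trans (map_mul h ⟨a, _⟩ ⟨b, _⟩).symm)
  ext z
  have hz : z ∈ closure {z | g z = h z} := by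
    rw [closure_subtype]
    refine closure_mono (fun a ha => ?_) z.2
    exact ⟨⟨a, Subalgebra.le_topologicalClosure _ ha⟩, hadj a ha, rfl⟩
  rwa [(isClosed_eq g.continuous h.continuous).closure_eq] at hz

end Closure

/-! ### The universal algebra and density -/

section Construction

variable (𝕜 : Type u) [RCLike 𝕜] (𝔤 : Type v) [LieRing 𝔤] [LieAlgebra 𝕜 𝔤] [TopologicalSpace 𝔤]

/-- The continuous matrix representations of `𝔤`. -/
abbrev MatrixRep : Type (max u v w) :=
  ULift.{w} (Σ n : ℕ, {f : 𝔤 →ₗ⁅𝕜⁆ Matrix (Fin n) (Fin n) 𝕜 // Continuous f})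

/-- The product of the matrix algebras over all continuous matrix representations of `𝔤`. -/
abbrev RepProduct : Type (max u v w) :=
  ∀ i : MatrixRep.{u, v, w} 𝕜 𝔤, Matrix (Fin i.down.1) (Fin i.down.1) 𝕜

instance : IsWeaklyCompleteAlgebra 𝕜 (RepProduct.{u, v, w} 𝕜 𝔤) where
  isWeaklyComplete := by
    refine ⟨Σ i : MatrixRep.{u, v, w} 𝕜 𝔤, Fin i.down.1 × Fin i.down.1, ⟨
      { toFun := fun x k => x k.1 k.2.1 k.2.2
        invFun := fun y i => Matrix.of fun r s => y ⟨i, r, s⟩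
        map_add' := fun _ _ => rfl
        map_smul' := fun _ _ => rfl
        left_inv := fun _ => rfl
        right_inv := fun _ => rfl
        continuous_toFun := continuous_pi fun k =>
          (continuous_apply k.1).matrix_elem k.2.1 k.2.2
        continuous_invFun := continuous_pi fun i => continuous_matrix fun r s =>
          continuous_apply _ }⟩⟩

/-- The tuple of all continuous matrix representations of `𝔤`. -/
def toRepProduct : 𝔤 →ₗ⁅𝕜⁆ RepProduct.{u, v, w} 𝕜 𝔤 where
  toFun x i := i.down.2.1 x
  map_add' x y := funext fun i => map_add i.down.2.1 x y
  map_smul' c x := funext fun i => map_smul i.down.2.1 c x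
  map_lie' {x y} := funext fun i => LieHom.map_lie i.down.2.1 x y

theorem continuous_toRepProduct : Continuous (toRepProduct.{u, v, w} 𝕜 𝔤) :=
  continuous_pi fun i => i.down.2.2

variable {𝕜 𝔤}

theorem continuous_toClosure {A : Type w} [Ring A] [Algebra 𝕜 A] [TopologicalSpace A]
    [IsTopologicalRing A] {f : 𝔤 →ₗ⁅𝕜⁆ A} (hf : Continuous f) : Continuous (toClosure f) :=
  hf.subtype_mk _

/-- The extension of a continuous Lie algebra morphism into a weakly complete algebra to the
closure of the subalgebra generated by all continuous matrix representations. -/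
theorem exists_lift_closure {A : Type (max u v w)} [Ring A] [Algebra 𝕜 A] [TopologicalSpace A]
    [hA : IsWeaklyCompleteAlgebra 𝕜 A] (f : 𝔤 →ₗ⁅𝕜⁆ A) (hf : Continuous f) :
    ∃ f' : (Algebra.adjoin 𝕜 (Set.range (toRepProduct.{u, v, w} 𝕜 𝔤))).topologicalClosure →A[𝕜] A,
      ∀ x, f' (toClosure (toRepProduct.{u, v, w} 𝕜 𝔤) x) = f x := by
  obtain ⟨J, ⟨e⟩⟩ := hA.isWeaklyComplete
  choose n ρ l hρ hl using fun j : J => exists_representation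
    ((ContinuousLinearMap.proj (R := 𝕜) (φ := fun _ : J => 𝕜) j).comp (e : A →L[𝕜] (J → 𝕜)))
  let i : J → MatrixRep.{u, v, w} 𝕜 𝔤 := fun j =>
    ⟨n j, ((ρ j : A →ₗ⁅𝕜⁆ Matrix (Fin (n j)) (Fin (n j)) 𝕜)).comp f, (hρ j).comp hf⟩
  -- `Ψ` is linear on the whole product, but multiplicative only where the components at `i j` come
  -- from a single element of `A`.
  let Ψ : RepProduct.{u, v, w} 𝕜 𝔤 →L[𝕜] A :=
    (e.symm : (J → 𝕜) →L[𝕜] A).comp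
      (ContinuousLinearMap.pi fun j => (LinearMap.toContinuousLinearMap (l j)).comp
        (ContinuousLinearMap.proj (i j)))
  have hΨ : ∀ p a, (∀ j, p (i j) = ρ j a) → Ψ p = a := by
    intro p a h
    apply e.injective
    funext j
    have hj : e (Ψ p) j = l j (p (i j)) := by simp [Ψ]
    rw [hj, h j, ← hl j]
    rfl
  have hadj : ∀ p ∈ Algebra.adjoin 𝕜 (Set.range (toRepProduct.{u, v, w} 𝕜 𝔤)),
      ∃ a, ∀ j, p (i j) = ρ j a := by
    intro p hp
    induction hp using Algebra.adjoin_induction with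
    | mem p hp => obtain ⟨x, rfl⟩ := hp; exact ⟨f x, fun j => rfl⟩
    | algebraMap r => exact ⟨algebraMap 𝕜 A r, fun j => ((ρ j).commutes r).symm⟩
    | add p q _ _ hp hq =>
      obtain ⟨a, ha⟩ := hp
      obtain ⟨b, hb⟩ := hq
      exact ⟨a + b, fun j => by rw [map_add, ← ha, ← hb]; rfl⟩
    | mul p q _ _ hp hq =>
      obtain ⟨a, ha⟩ := hp
      obtain ⟨b, hb⟩ := hq
      exact ⟨a * b, fun j => by rw [map_mul, ← ha, ← hb]; rfl⟩
  -- Taking `Ψ p` as the witness `a` of `hadj` turns the existence statement into a closed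
  -- condition.
  have hcl : ∀ p ∈ (Algebra.adjoin 𝕜
      (Set.range (toRepProduct.{u, v, w} 𝕜 𝔤))).topologicalClosure,
      ∀ j, p (i j) = ρ j (Ψ p) := by
    intro p hp j
    have hclosed : IsClosed {p : RepProduct.{u, v, w} 𝕜 𝔤 | p (i j) = ρ j (Ψ p)} :=
      isClosed_eq (continuous_apply (i j)) ((hρ j).comp Ψ.continuous)
    refine closure_minimal (fun q hq => ?_) hclosed hp
    obtain ⟨a, ha⟩ := hadj q hq
    rw [Set.mem_ofPred_eq, hΨ q a ha, ha j]
  refine ⟨{ toFun := fun p => Ψ p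
            map_one' := hΨ 1 1 fun j => (map_one (ρ j)).symm
            map_mul' := fun p q => hΨ _ _ fun j => ?_
            map_zero' := map_zero Ψ
            map_add' := fun p q => map_add Ψ p.1 q.1
            commutes' := fun r => hΨ _ _ fun j => ((ρ j).commutes r).symm
            cont := Ψ.continuous.comp continuous_subtype_val }, fun x => ?_⟩
  · rw [map_mul, ← hcl _ p.2 j, ← hcl _ q.2 j]
    rfl
  · exact hΨ _ _ fun j => rfl

variable (𝕜 𝔤)

theorem isEnvelopingAlgebra_closure :
    IsEnvelopingAlgebra 𝕜 𝔤
      (Algebra.adjoin 𝕜 (Set.range (toRepProduct.{u, v, w} 𝕜 𝔤))).topologicalClosure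
      (toClosure (toRepProduct.{u, v, w} 𝕜 𝔤)) where
  weaklyComplete := IsWeaklyCompleteAlgebra.of_isClosed _
    (Subalgebra.isClosed_topologicalClosure _)
  continuous := continuous_toClosure (continuous_toRepProduct 𝕜 𝔤)
  existsUnique_lift A _ _ _ hA f hf := by
    have := hA.isWeaklyComplete.t2Space
    obtain ⟨f', hf'⟩ := exists_lift_closure.{u, v, w} f hf
    exact ⟨f', hf', fun g hg => algHom_closure_ext fun x => (hg x).trans (hf' x).symm⟩

variable {𝕜 𝔤}

theorem IsEnvelopingAlgebra.dense_adjoin {U : Type w} [Ring U] [Algebra 𝕜 U]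
    [TopologicalSpace U] {lam : 𝔤 →ₗ⁅𝕜⁆ U} (h : IsEnvelopingAlgebra 𝕜 𝔤 U lam) :
    Dense (Algebra.adjoin 𝕜 (Set.range lam) : Set U) := by
  have := h.weaklyComplete
  let S := (Algebra.adjoin 𝕜 (Set.range lam)).topologicalClosure
  have hS : IsWeaklyCompleteAlgebra 𝕜 S :=
    IsWeaklyCompleteAlgebra.of_isClosed S (Subalgebra.isClosed_topologicalClosure _)
  obtain ⟨r, hr, -⟩ := h.existsUnique_lift S (toClosure lam) (continuous_toClosure h.continuous)
  let ι : S →A[𝕜] U := { S.val with cont := continuous_subtype_val }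
  -- Both maps fix `lam`, so uniqueness applies; every element of `U` then lies in `S`.
  have hid : ι.comp r = ContinuousAlgHom.id 𝕜 U :=
    (h.existsUnique_lift U lam h.continuous).unique
      (fun x => congrArg Subtype.val (hr x)) fun x => rfl
  intro z
  have hz : ((r z : S) : U) = z := congrArg (fun g : U →A[𝕜] U => g z) hid
  rw [← hz]
  exact (r z).2

end Construction

end ProfiniteLie

theorem corollary1p8 (𝕜 : Type u) [RCLike 𝕜] (𝔤 : Type v) [LieRing 𝔤] [LieAlgebra 𝕜 𝔤]
    [TopologicalSpace 𝔤] [ProfiniteLie.IsProfiniteDimensional 𝕜 𝔤] :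
    (∃ (U : Type (max u v w)) (_ : Ring U) (_ : Algebra 𝕜 U) (_ : TopologicalSpace U)
      (lam : 𝔤 →ₗ⁅𝕜⁆ U), ProfiniteLie.IsEnvelopingAlgebra 𝕜 𝔤 U lam) ∧
    ∀ (U : Type (max u v w)) [Ring U] [Algebra 𝕜 U] [TopologicalSpace U] (lam : 𝔤 →ₗ⁅𝕜⁆ U),
      ProfiniteLie.IsEnvelopingAlgebra 𝕜 𝔤 U lam →
        Dense (Algebra.adjoin 𝕜 (Set.range lam) : Set U) :=
  ⟨⟨_, inferInstance, inferInstance, inferInstance, _,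
      ProfiniteLie.isEnvelopingAlgebra_closure.{u, v, w} 𝕜 𝔤⟩,
    fun _ _ _ _ _ h => h.dense_adjoin⟩
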